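/- Let $k$ be a field of characteristic $0$ and $G$ a finite group. Let $X$ be a quasiprojective $G$-variety over $k$, i.e. an integral quasiprojective $k$-scheme with a faithful action of $G$ by $k$-automorphisms. For a closed point $x$, let $\operatorname{Stab}(x)$ be the group of those $g\in G$ with $gx=x$ that act trivially on the residue field $k(x)$; an action is called free on a subset if all closed points of that subset have trivial $\operatorname{Stab}$. Suppose that $X$ is generically free (the action is free on some nonempty $G$-invariant open subset) and in standard form with respect to a (reduced) divisor $Y$, i.e. (i) $X$ is smooth over $k$ and $Y$ is a normal crossing divisor: at each closed point, the irreducible components of $Y$ through that point are defined by distinct members of a local coordinate system; (ii) $G$ acts freely on $X-Y$; (iii) for every $g\in G$ and every irreducible component $Y_0$ of $Y$, either $g(Y_0)=Y_0$ or $g(Y_0)\cap Y_0=\emptyset$. Here a local coordinate system at $x$ is a family of elements of ${\mathfrak m}_x\subset{\mathcal O}_{x,X}$ whose classes form a $k(x)$-basis of ${\mathfrak m}_x/{\mathfrak m}_x^2$. Let $x$ be a closed point of $X$, let $Y_1,\dots,Y_m$ be the distinct irreducible components of $Y$ passing through $x$, and let $u_1,\dots,u_m,v_1,\dots,v_l$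 be a local coordinate system at $x$ such that (a) the class modulo ${\mathfrak m}_x^2$ of each $u_i$ and of each $v_j$ spans a one-dimensional $k(x)$-subspace of ${\mathfrak m}_x/{\mathfrak m}_x^2$ invariant under all $g\in G$ with $gx=x$; (b) for every $i$ and every $g\in G$, $u_i$ is a local equation of $g(Y_i)$ at $gx$ (i.e. $u_i$ is regular at $gx$ and generates the ideal of $g(Y_i)$ in ${\mathcal O}_{gx,X}$); (c) for every $j$ there are given integers $e_{j1},\dots,e_{jm}\ge 0$ such that $h_j=u_1^{e_{j1}}\cdots u_m^{e_{jm}}v_j$ is a $G$-invariant rational function on $X$. Put $w_i=\prod_{g\in G}g^*(u_i)$. Then the $w_i$ and $h_j$ are nonzero $G$-invariant rational functions on $X$, and for every nonzero rational function $f$ on $X$ whose divisor is supported on $Y$, $$\frac{df}{f}\in\mathcal M,$$ where $\mathcal M$ is the ${\mathcal O}_{x,X}$-submodule of the module $\Omega^1_{k(X)/k}$ of rational differential forms generated by $dw_i/w_i$ ($i=1,\dots,m$) and $dh_j/h_j$ ($j=1,\dots,l$). -/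

import Mathlib

open CategoryTheory AlgebraicGeometry

universe u v

noncomputable section

/-- Projective space `ℙⁿ` over a field `k`, as `Proj k[x₀, …, xₙ]`, with its structure morphism. -/
def projSpaceOver (k : Type u) [Field k] (n : ℕ) : Over (Spec (.of k)) :=
  letI := MvPolynomial.gradedAlgebra (σ := Fin (n + 1)) (R := k)
  Over.mk (Proj.toSpecZero (MvPolynomial.homogeneousSubmodule (Fin (n + 1)) k) ≫
    Spec.map (CommRingCat.ofHom
      (algebraMap k (MvPolynomial.homogeneousSubmodule (Fin (n + 1)) k 0))))

/-- A `G`-variety over `k`: an integral separated scheme of finite type over `k` with a faithful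
left action of `G` by automorphisms over `k`. (In `Aut X` the product `a * b` is "first `b`,
then `a`", so a homomorphism `G →* Aut X` is a left action.) -/
structure GVariety (k : Type u) [Field k] (G : Type v) [Group G] where
  X : Scheme.{u}
  π : X ⟶ Spec (.of k)
  isIntegral : IsIntegral X
  isSeparated : IsSeparated π
  locallyOfFiniteType : LocallyOfFiniteType π
  quasiCompact : QuasiCompact π
  act : G →* Aut X
  act_over : ∀ g, (act g).hom ≫ π = π
  faithful : Function.Injective act

/-- For `φ : X ⟶ X` with `φ x = y`, the pullback of germs `φ^* : 𝒪_{X,y} → 𝒪_{X,x}`. -/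
def germPullback {X : Scheme.{u}} (φ : X ⟶ X) {x y : X} (h : φ x = y) :
    X.presheaf.stalk y →+* X.presheaf.stalk x :=
  (X.presheaf.stalkSpecializes (specializes_of_eq h) ≫ φ.stalkMap x).hom

/-- The ideal in `𝒪_{X,y}` of the germs vanishing on the closed subset `Z`: the intersection of
the primes of `𝒪_{X,y}` (points of `X` specializing to `y`) that belong to `Z`. -/
def vanishingIdealAt {X : Scheme.{u}} (Z : Set X) (y : X) : Ideal (X.presheaf.stalk y) :=
  ⨅ z : {z : X // z ∈ Z ∧ z ⤳ y},
    (IsLocalRing.maximalIdeal (X.presheaf.stalk z.1)).comap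
      (X.presheaf.stalkSpecializes z.2.2).hom

/-- The irreducible components of a subset `Y` of a topological space `T`, as subsets of `T`. -/
def componentsOf {T : Type*} [TopologicalSpace T] (Y : Set T) : Set (Set T) :=
  {Z | Maximal (fun S => IsIrreducible S ∧ S ⊆ Y) Z}

/-- `t` is a local coordinate system at `x`: a family of elements of `𝔪_x` whose classes form a
basis of `𝔪_x/𝔪_x²` over the residue field. -/
def IsLocalCoordinateSystem {X : Scheme.{u}} (x : X) {ι : Type*}
    (t : ι → IsLocalRing.maximalIdeal (X.presheaf.stalk x)) : Prop :=
  LinearIndependent (IsLocalRing.ResidueField (X.presheaf.stalk x))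
      (fun i => (IsLocalRing.maximalIdeal (X.presheaf.stalk x)).toCotangent (t i) :
        ι → IsLocalRing.CotangentSpace (X.presheaf.stalk x)) ∧
    Submodule.span (IsLocalRing.ResidueField (X.presheaf.stalk x))
      (Set.range (fun i => (IsLocalRing.maximalIdeal (X.presheaf.stalk x)).toCotangent (t i) :
        ι → IsLocalRing.CotangentSpace (X.presheaf.stalk x))) = ⊤

/-- The closed subset `Y`, viewed as a reduced divisor, has normal crossings: at every closed point
`x`, the irreducible components of `Y` through `x` are defined by distinct members of a local
coordinate system at `x`. (So the components are smooth hypersurfaces meeting transversally.) -/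
def IsNormalCrossingDivisor {X : Scheme.{u}} (Y : Set X) : Prop :=
  IsClosed Y ∧ ∀ x : X, IsClosed ({x} : Set X) →
    ∃ (n : ℕ) (t : Fin n → IsLocalRing.maximalIdeal (X.presheaf.stalk x))
      (c : {Z : Set X // Z ∈ componentsOf Y ∧ x ∈ Z} → Fin n),
      IsLocalCoordinateSystem x t ∧ Function.Injective c ∧
      ∀ Z, Ideal.span {(t (c Z) : X.presheaf.stalk x)} = vanishingIdealAt Z.1 x

namespace GVariety

variable {k : Type u} [Field k] {G : Type v} [Group G] (V : GVariety k G)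

instance : IsIntegral V.X := V.isIntegral

instance : LocallyOfFiniteType V.π := V.locallyOfFiniteType

instance (g : G) : IsIso (V.act g).hom := Iso.isIso_hom (V.act g)

instance : IsLocallyNoetherian V.X := LocallyOfFiniteType.isLocallyNoetherian V.π

/-- The function field `k(X)` as a `k`-algebra. -/
instance : Algebra k V.X.functionField :=
  ((Scheme.ΓSpecIso (.of k)).inv ≫ V.π.appTop ≫
    V.X.presheaf.germ ⊤ (genericPoint V.X) trivial).hom.toAlgebra

/-- `X` is quasiprojective: it admits an immersion over `k` into some `ℙⁿ`. -/
def IsQuasiprojective : Prop :=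
  ∃ (n : ℕ) (i : V.X ⟶ (projSpaceOver k n).left),
    IsImmersion i ∧ i ≫ (projSpaceOver k n).hom = V.π

/-- `g` lies in the stabilizer `Stab(x)` (inertia group): `g x = x` and `g` acts trivially on the
residue field of `x`. -/
def MemStab (g : G) (x : V.X) : Prop :=
  ∃ h : (V.act g).hom x = x, ∀ s : V.X.presheaf.stalk x,
    germPullback (V.act g).hom h s - s ∈ IsLocalRing.maximalIdeal (V.X.presheaf.stalk x)

/-- `G` acts freely on the subset `U`: closed points in `U` have trivial stabilizers. -/
def IsFreeOn (U : Set V.X) : Prop :=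
  ∀ x ∈ U, IsClosed ({x} : Set V.X) → ∀ g : G, V.MemStab g x → g = 1

/-- `X` is a generically free `G`-variety in standard form with respect to the divisor `Y`. -/
structure IsStandardForm (Y : Set V.X) : Prop where
  generically_free : ∃ U : V.X.Opens, (U : Set V.X).Nonempty ∧
    (∀ g : G, ∀ x ∈ U, (V.act g).hom x ∈ U) ∧ V.IsFreeOn U
  smooth : Smooth V.π
  normal_crossing : IsNormalCrossingDivisor Y
  free : V.IsFreeOn Yᶜ
  components : ∀ g : G, ∀ Z ∈ componentsOf Y,
    (V.act g).hom '' Z = Z ∨ (V.act g).hom '' Z ∩ Z = ∅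

/-- The action `g^*` of `g` on rational functions, `g^*(φ) = φ ∘ g`. -/
def ratPullback (g : G) : V.X.functionField →+* V.X.functionField :=
  germPullback (V.act g).hom (genericPoint_eq_of_isOpenImmersion (V.act g).hom)

/-- The rational function on `X` defined by a germ at `x`. -/
def toRat (x : V.X) : V.X.presheaf.stalk x →+* V.X.functionField :=
  algebraMap (V.X.presheaf.stalk x) V.X.functionField

/-- The rational function `r` is a local equation of `Z` at `y`: it is regular at `y` and generates
the ideal of `Z` in `𝒪_{X,y}`. -/
def IsLocalEquation (r : V.X.functionField) (Z : Set V.X) (y : V.X) : Prop :=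
  ∃ t : V.X.presheaf.stalk y, V.toRat y t = r ∧ Ideal.span {t} = vanishingIdealAt Z y

/-- The class of `t ∈ 𝔪_x` in `𝔪_x/𝔪_x²` spans a `k(x)`-subspace that is invariant under all
`g ∈ G` with `g x = x`. -/
def SpansInvariantLine (x : V.X) (t : IsLocalRing.maximalIdeal (V.X.presheaf.stalk x)) : Prop :=
  ∀ (g : G) (h : (V.act g).hom x = x),
    ∃ t' : IsLocalRing.maximalIdeal (V.X.presheaf.stalk x),
      (t' : V.X.presheaf.stalk x) = germPullback (V.act g).hom h t ∧
      ((IsLocalRing.maximalIdeal (V.X.presheaf.stalk x)).toCotangent t' :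
          IsLocalRing.CotangentSpace (V.X.presheaf.stalk x)) ∈
        Submodule.span (IsLocalRing.ResidueField (V.X.presheaf.stalk x))
          {((IsLocalRing.maximalIdeal (V.X.presheaf.stalk x)).toCotangent t :
            IsLocalRing.CotangentSpace (V.X.presheaf.stalk x))}

/-- The rational function `h_j = u₁^{e_{j1}} ⋯ u_m^{e_{jm}} v_j`. -/
def hFun {x : V.X} {m l : ℕ} (u : Fin m → IsLocalRing.maximalIdeal (V.X.presheaf.stalk x))
    (v : Fin l → IsLocalRing.maximalIdeal (V.X.presheaf.stalk x)) (e : Fin l → Fin m → ℕ)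
    (j : Fin l) : V.X.functionField :=
  (∏ i, V.toRat x (u i) ^ e j i) * V.toRat x (v j)

/-- The rational function `w_i = ∏_{g ∈ G} g^*(u_i)`. -/
def wFun [Fintype G] {x : V.X} {m : ℕ}
    (u : Fin m → IsLocalRing.maximalIdeal (V.X.presheaf.stalk x)) (i : Fin m) :
    V.X.functionField :=
  ∏ g : G, V.ratPullback g (V.toRat x (u i))

/-- `u₁, …, u_m, v₁, …, v_l` is a local coordinate system at `x` adapted to the components
`Ys₁, …, Ys_m` of `Y` through `x` and to the `G`-action, with exponents `e_{ji}`. -/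
structure IsAdaptedCoordinateSystem (Y : Set V.X) (x : V.X) {m l : ℕ} (Ys : Fin m → Set V.X)
    (u : Fin m → IsLocalRing.maximalIdeal (V.X.presheaf.stalk x))
    (v : Fin l → IsLocalRing.maximalIdeal (V.X.presheaf.stalk x))
    (e : Fin l → Fin m → ℕ) : Prop where
  components_injective : Function.Injective Ys
  components_range : Set.range Ys = {Z | Z ∈ componentsOf Y ∧ x ∈ Z}
  coordinates : IsLocalCoordinateSystem x (Sum.elim u v)
  invariant_u : ∀ i, V.SpansInvariantLine x (u i)
  invariant_v : ∀ j, V.SpansInvariantLine x (v j)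
  local_equation : ∀ (i : Fin m) (g : G),
    V.IsLocalEquation (V.toRat x (u i)) ((V.act g).hom '' Ys i) ((V.act g).hom x)
  invariant_h : ∀ (j : Fin l) (g : G), V.ratPullback g (V.hFun u v e j) = V.hFun u v e j

/-- The divisor of the rational function `f` is supported on `Y`: every prime divisor (given by
its generic point `z`) along which `f` has nonzero order is contained in `Y`. -/
def DivisorSupportedOn (f : V.X.functionField) (Y : Set V.X) : Prop :=
  ∀ z : V.X, Order.coheight z = 1 → Scheme.ord f z ≠ 0 → z ∈ Y

/-- The logarithmic differential `df/f`, a rational differential form on `X`. -/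
def dlog (f : V.X.functionField) : Ω[V.X.functionField⁄k] :=
  f⁻¹ • KaehlerDifferential.D k V.X.functionField f

end GVariety

end

-- As `𝒪 = 𝒪_{X,x}` is normal and the `u_i` are primes cutting out the components of `Y` through
-- `x`, the function `f` is a unit of `𝒪` times a Laurent monomial in the `u_i`. Let `L` be the
-- `𝒪`-module spanned by all `du_i/u_i` and `dv_j/v_j`. Residue fields being separable over `k`, the
-- differentials of the coordinates generate `Ω¹` near `x`, so that `da ∈ 𝔪 L` for every `a ∈ 𝒪`;
-- in particular `df/f ∈ L`, and `dc/c ∈ 𝔪 L` for units `c`. Since `w_i` is a unit times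
-- `u_i ^ |G|` and `h_j` is a monomial in the `u_i` times `v_j`, this gives `L ⊆ M + 𝔪 L` for the
-- span `M` of the `dw_i/w_i` and `dh_j/h_j`, and Nakayama's lemma yields `L ⊆ M`.

section Normality

open TensorProduct nonZeroDivisors

section Etale

variable (P S K : Type*) [CommRing P] [IsDomain P] [CommRing S] [IsDomain S] [Algebra P S]
  [Algebra.Etale P S] [Field K] [Algebra P K] [IsFractionRing P K]

theorem algebraMapSubmonoid_le_nonZeroDivisors_of_etale :
    Algebra.algebraMapSubmonoid S P⁰ ≤ S⁰ := by
  rintro _ ⟨p, hp, rfl⟩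
  exact mem_nonZeroDivisors_of_ne_zero ((map_ne_zero_iff _
    (FaithfulSMul.algebraMap_injective P S)).2 (nonZeroDivisors.ne_zero hp))

theorem isField_tensorProduct_of_etale : IsField (S ⊗[P] K) := by
  have : IsLocalization (Algebra.algebraMapSubmonoid S P⁰) (S ⊗[P] K) := inferInstance
  have : IsDomain (S ⊗[P] K) := IsLocalization.isDomain_of_le_nonZeroDivisors _
    (algebraMapSubmonoid_le_nonZeroDivisors_of_etale P S)
  have : IsDomain (K ⊗[P] S) := (Algebra.TensorProduct.comm P K S).toMulEquiv.isDomain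
  have : Module.Finite K (K ⊗[P] S) := Algebra.FormallyUnramified.finite_of_free K (K ⊗[P] S)
  exact (Algebra.TensorProduct.comm P S K).toMulEquiv.isField
    (isField_of_isIntegral_of_isField' (Field.toIsField K))

theorem isFractionRing_tensorProduct_of_etale : IsFractionRing S (S ⊗[P] K) := by
  have hle := algebraMapSubmonoid_le_nonZeroDivisors_of_etale P S
  have : IsLocalization (Algebra.algebraMapSubmonoid S P⁰) (S ⊗[P] K) := inferInstance
  refine IsLocalization.of_le (Algebra.algebraMapSubmonoid S P⁰) S⁰ hle fun r hr => ?_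
  have hr0 : algebraMap S (S ⊗[P] K) r ≠ 0 :=
    (map_ne_zero_iff _ (IsLocalization.injective _ hle)).2 (nonZeroDivisors.ne_zero hr)
  obtain ⟨y, hy⟩ := (isField_tensorProduct_of_etale P S K).mul_inv_cancel hr0
  exact IsUnit.of_mul_eq_one y hy

theorem isIntegrallyClosed_of_etale [IsIntegrallyClosed P] : IsIntegrallyClosed S := by
  let K := FractionRing P
  let := (isField_tensorProduct_of_etale P S K).toField
  have := isFractionRing_tensorProduct_of_etale P S K
  refine (isIntegrallyClosed_iff (S ⊗[P] K)).2 fun {x} hx => ?_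
  -- The integral closure of `S` in `S ⊗ K` is generated by the integral closure of `P` in `K`.
  obtain ⟨y, hy⟩ := (TensorProduct.toIntegralClosure_bijective_of_smooth
    (R := P) (S := S) (B := K)).2 ⟨x, hx⟩
  obtain rfl : (TensorProduct.toIntegralClosure P S K y : S ⊗[P] K) = x := congr_arg Subtype.val hy
  clear hx hy
  induction y with
  | zero => exact ⟨0, by simp⟩
  | add a b ha hb =>
    obtain ⟨a', ha⟩ := ha
    obtain ⟨b', hb⟩ := hb
    exact ⟨a' + b', by rw [map_add, ha, hb, map_add]; rfl⟩
  | tmul s b =>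
    obtain ⟨c, hc⟩ := (isIntegrallyClosed_iff K).1 ‹_› b.2
    refine ⟨c • s, ?_⟩
    change (c • s) ⊗ₜ[P] (1 : K) = s ⊗ₜ[P] (b : K)
    rw [← hc, TensorProduct.smul_tmul, Algebra.algebraMap_eq_smul_one]

end Etale

theorem isIntegrallyClosed_of_smooth (k S : Type*) [Field k] [CommRing S] [IsDomain S]
    [Algebra k S] [Algebra.Smooth k S] : IsIntegrallyClosed S := by
  refine .of_localization_maximal fun p _ hp => ?_
  have : Algebra.IsSmoothAt k p := by
    have hp' : (⟨p, hp.isPrime⟩ : PrimeSpectrum S) ∈ Algebra.smoothLocus k S :=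
      Algebra.smoothLocus_eq_univ (R := k) (A := S) ▸ Set.mem_univ _
    exact hp'
  obtain ⟨f, hfp, n, _, _, _⟩ :=
    Algebra.IsSmoothAt.exists_isStandardEtale_mvPolynomial (R := k) (p := p)
  have hf : Submonoid.powers f ≤ p.primeCompl := Submonoid.powers_le.2 hfp
  have : IsDomain (Localization.Away f) :=
    IsLocalization.isDomain_localization (hf.trans p.primeCompl_le_nonZeroDivisors)
  have : IsIntegrallyClosed (Localization.Away f) :=
    isIntegrallyClosed_of_etale (MvPolynomial (Fin n) k) _
  let := IsLocalization.localizationAlgebraOfSubmonoidLe (Localization.Away f)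
    (Localization.AtPrime p) _ _ hf
  have := IsLocalization.localization_isScalarTower_of_submonoid_le (Localization.Away f)
    (Localization.AtPrime p) _ _ hf
  have := IsLocalization.isLocalization_of_submonoid_le (Localization.Away f)
    (Localization.AtPrime p) _ _ hf
  refine isIntegrallyClosed_of_isLocalization (Localization.AtPrime p)
    (p.primeCompl.map (algebraMap S (Localization.Away f))) ?_
  exact map_le_nonZeroDivisors_of_injective _
    (IsLocalization.injective _ (hf.trans p.primeCompl_le_nonZeroDivisors))
    p.primeCompl_le_nonZeroDivisors

theorem exists_isPrime_colon_singleton {A M : Type*} [CommRing A] [IsNoetherianRing A]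
    [AddCommGroup M] [Module A M] (N : Submodule A M) {x : M} (hx : x ∉ N) :
    ∃ y, (N.colon {y}).IsPrime ∧ N.colon {x} ≤ N.colon {y} := by
  have hcolon (z : M) : (⊥ : Submodule A (M ⧸ N)).colon {N.mkQ z} = N.colon {z} := by
    ext a
    rw [Submodule.mem_colon_singleton, Submodule.mem_colon_singleton, Submodule.mem_bot,
      ← map_smul, Submodule.mkQ_apply, Submodule.Quotient.mk_eq_zero]
  obtain ⟨p, hp, hle⟩ := exists_le_isAssociatedPrime_of_isNoetherianRing A (N.mkQ x)
    (by rwa [Ne, Submodule.mkQ_apply, Submodule.Quotient.mk_eq_zero])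
  obtain ⟨hprime, y, hy⟩ := (Submodule.isAssociatedPrime_iff (N := ⊥)).1 hp
  obtain ⟨y, rfl⟩ := N.mkQ_surjective y
  rw [hcolon] at hle hy
  exact ⟨y, hy ▸ hprime, hy ▸ hle⟩

theorem algebraMap_ne_zero {A B : Type*} [CommRing A] [CommRing B] [Algebra A B] [FaithfulSMul A B]
    {a : A} (ha : a ≠ 0) : algebraMap A B a ≠ 0 :=
  (FaithfulSMul.algebraMap_eq_zero_iff A B).not.2 ha

section HeightOne

variable {A K : Type*} [CommRing A] [IsDomain A] [Field K] [Algebra A K] [IsFractionRing A K]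

theorem colon_one_singleton_ne_bot (y : K) : (1 : Submodule A K).colon {y} ≠ ⊥ := by
  obtain ⟨a, b, hb, rfl⟩ := IsFractionRing.div_surjective (A := A) y
  have hb0 := nonZeroDivisors.ne_zero hb
  refine (Submodule.ne_bot_iff _).2 ⟨b, ?_, hb0⟩
  rw [Submodule.mem_colon_singleton, Submodule.mem_one, Algebra.smul_def,
    mul_div_cancel₀ _ (algebraMap_ne_zero hb0)]
  exact ⟨a, rfl⟩

variable [IsNoetherianRing A] [IsIntegrallyClosed A]

theorem exists_algebraMap_eq_smul_of_isPrime_colon {y : K}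
    (hy : ((1 : Submodule A K).colon {y}).IsPrime) :
    ∃ t ∈ (1 : Submodule A K).colon {y}, ∃ s ∉ (1 : Submodule A K).colon {y},
      algebraMap A K s = t • y := by
  set p := (1 : Submodule A K).colon {y} with hp
  have hmem (a : A) : a ∈ p ↔ ∃ b, algebraMap A K b = a • y := by
    rw [hp, Submodule.mem_colon_singleton, Submodule.mem_one]
  by_contra! hcon
  -- Otherwise `y p ⊆ p`, so `y` is integral over `A`.
  have hint : IsIntegral A y := by
    refine isIntegral_of_smul_mem_submodule (Submodule.map (Algebra.linearMap A K) p) ?_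
      ((IsNoetherian.noetherian p).map _) y ?_
    · obtain ⟨z, hz, hz0⟩ := Submodule.exists_mem_ne_zero_of_ne_bot
        (colon_one_singleton_ne_bot (A := A) y)
      exact (Submodule.ne_bot_iff _).2 ⟨_, ⟨z, hz, rfl⟩, algebraMap_ne_zero hz0⟩
    · rintro _ ⟨t, ht, rfl⟩
      obtain ⟨s, hs⟩ := (hmem t).1 ht
      refine ⟨s, by_contra fun h => hcon t ht s h hs, ?_⟩
      rw [Algebra.linearMap_apply, Algebra.linearMap_apply, hs, Algebra.smul_def, smul_eq_mul,
        mul_comm]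
  obtain ⟨b, hb⟩ := (isIntegrallyClosed_iff K).1 ‹_› hint
  exact hy.ne_top ((Ideal.eq_top_iff_one _).2 ((hmem 1).2 ⟨b, by rw [hb, one_smul]⟩))

theorem height_colon_one_singleton {y : K} (hy : ((1 : Submodule A K).colon {y}).IsPrime) :
    ((1 : Submodule A K).colon {y}).height = 1 := by
  obtain ⟨t, ht, s, hs, hst⟩ := exists_algebraMap_eq_smul_of_isPrime_colon hy
  set p := (1 : Submodule A K).colon {y}
  have hmin : p ∈ (Ideal.span {t}).minimalPrimes := by
    refine ⟨⟨hy, (Ideal.span_singleton_le_iff_mem _).2 ht⟩, fun q ⟨hq, htq⟩ hqp a ha => ?_⟩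
    obtain ⟨r, hr⟩ := Submodule.mem_one.1 (Submodule.mem_colon_singleton.1 ha)
    have hsa : s * a = r * t := IsFractionRing.injective A K (by
      rw [map_mul, map_mul, hst, hr, Algebra.smul_def, Algebra.smul_def]; ring)
    have hsaq : s * a ∈ q :=
      hsa ▸ q.mul_mem_left r ((Ideal.span_singleton_le_iff_mem _).1 htq)
    exact (hq.mem_or_mem hsaq).resolve_left fun h => hs (hqp h)
  refine le_antisymm (Ideal.height_le_one_of_isPrincipal_of_mem_minimalPrimes _ p hmin) ?_
  rw [Order.one_le_iff_ne_zero, Ne, Ideal.height_eq_zero_iff_eq_bot]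
  exact colon_one_singleton_ne_bot y

theorem mem_one_of_forall_height_eq_one {f : K}
    (hf : ∀ p : Ideal A, p.IsPrime → p.height = 1 → ¬ (1 : Submodule A K).colon {f} ≤ p) :
    f ∈ (1 : Submodule A K) := by
  by_contra hfA
  obtain ⟨y, hy, hle⟩ := exists_isPrime_colon_singleton _ hfA
  exact hf _ hy (height_colon_one_singleton hy) hle

end HeightOne

/-- The element `f` of a field containing the ring `A` is a unit of the local ring `A_p`. -/
def IsUnitAt {A K : Type*} [CommRing A] [Field K] [Algebra A K] (p : Ideal A) (f : K) : Prop :=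
  ∃ a ∉ p, ∃ b ∉ p, algebraMap A K b * f = algebraMap A K a

namespace IsUnitAt

variable {A K : Type*} [CommRing A] [Field K] [Algebra A K] {p : Ideal A} {f g : K}

theorem of_notMem [p.IsPrime] {a : A} (ha : a ∉ p) : IsUnitAt p (algebraMap A K a) :=
  ⟨a, ha, 1, p.one_notMem, by rw [map_one, one_mul]⟩

theorem mul [hp : p.IsPrime] (hf : IsUnitAt p f) (hg : IsUnitAt p g) : IsUnitAt p (f * g) := by
  obtain ⟨a, ha, b, hb, hab⟩ := hf
  obtain ⟨c, hc, d, hd, hcd⟩ := hg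
  refine ⟨a * c, hp.mul_notMem ha hc, b * d, hp.mul_notMem hb hd, ?_⟩
  rw [map_mul, map_mul, ← hab, ← hcd, mul_mul_mul_comm]

theorem inv (hf : IsUnitAt p f) (hf0 : f ≠ 0) : IsUnitAt p f⁻¹ := by
  obtain ⟨a, ha, b, hb, hab⟩ := hf
  exact ⟨b, hb, a, ha, by rw [← hab, mul_inv_cancel_right₀ hf0]⟩

theorem prod [p.IsPrime] {ι : Type*} {s : Finset ι} {f : ι → K}
    (hf : ∀ i ∈ s, IsUnitAt p (f i)) : IsUnitAt p (∏ i ∈ s, f i) :=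
  Finset.prod_induction f (IsUnitAt p) (fun _ _ => mul)
    ⟨1, p.one_notMem, 1, p.one_notMem, mul_one _⟩ hf

theorem pow [p.IsPrime] (hf : IsUnitAt p f) (n : ℕ) : IsUnitAt p (f ^ n) := by
  rw [← Finset.card_range n, ← Finset.prod_const]
  exact prod fun _ _ => hf

theorem zpow [p.IsPrime] (hf : IsUnitAt p f) (hf0 : f ≠ 0) (n : ℤ) : IsUnitAt p (f ^ n) := by
  cases n with
  | ofNat n => simpa only [Int.ofNat_eq_natCast, zpow_natCast] using hf.pow n
  | negSucc n =>
    rw [zpow_negSucc]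
    exact (hf.pow _).inv (pow_ne_zero _ hf0)

theorem not_colon_le (hf : IsUnitAt p f) : ¬ (1 : Submodule A K).colon {f} ≤ p := by
  obtain ⟨a, -, b, hb, hab⟩ := hf
  refine fun h => hb (h ?_)
  rw [Submodule.mem_colon_singleton, Submodule.mem_one, Algebra.smul_def]
  exact ⟨a, hab.symm⟩

end IsUnitAt

section DivisorOfFunction

variable {A K ι : Type*} [CommRing A] [IsDomain A] [IsNoetherianRing A] [Field K] [Algebra A K]
  [IsFractionRing A K]

theorem exists_unit_eq_of_forall_isUnitAt [IsIntegrallyClosed A] {f : K} (hf0 : f ≠ 0)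
    (hf : ∀ p : Ideal A, p.IsPrime → p.height = 1 → IsUnitAt p f) :
    ∃ c : Aˣ, algebraMap A K c = f := by
  obtain ⟨c, hc⟩ := Submodule.mem_one.1 <|
    mem_one_of_forall_height_eq_one fun p hp h1 => (hf p hp h1).not_colon_le
  obtain ⟨d, hd⟩ := Submodule.mem_one.1 <|
    mem_one_of_forall_height_eq_one fun p hp h1 => ((hf p hp h1).inv hf0).not_colon_le
  have hcd : c * d = 1 := IsFractionRing.injective A K (by
    rw [map_mul, hc, hd, map_one, mul_inv_cancel₀ hf0])
  exact ⟨.mkOfMulEqOne c d hcd, hc⟩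

theorem exists_eq_mul_prod_pow_of_prime {u : ι → A} (hu : ∀ i, Prime (u i)) (s : Finset ι)
    {a : A} (ha : a ≠ 0) :
    ∃ (b : A) (n : ι → ℕ), a = b * ∏ i ∈ s, u i ^ n i ∧ ∀ i ∈ s, ¬ u i ∣ b := by
  classical
  induction s using Finset.induction_on with
  | empty => exact ⟨a, 0, by simp⟩
  | insert i s hi ih =>
    obtain ⟨b, n, rfl, hb⟩ := ih
    obtain ⟨r, c, hc, rfl⟩ :=
      WfDvdMonoid.max_power_factor (left_ne_zero_of_mul ha) (hu i).irreducible
    refine ⟨c, Function.update n i r, ?_, ?_⟩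
    · have hs : ∏ j ∈ s, u j ^ Function.update n i r j = ∏ j ∈ s, u j ^ n j :=
        Finset.prod_congr rfl fun j hj => by
          rw [Function.update_of_ne (ne_of_mem_of_not_mem hj hi)]
      rw [Finset.prod_insert hi, hs, Function.update_self]
      ring
    · exact Finset.forall_mem_insert _ _ _ |>.2 ⟨hc, fun j hj h => hb j hj (h.mul_left _)⟩

theorem exists_eq_div_mul_prod_zpow [Fintype ι] {u : ι → A} (hu : ∀ i, Prime (u i)) {f : K}
    (hf : f ≠ 0) :
    ∃ (a b : A) (n : ι → ℤ), (∀ i, ¬ u i ∣ a) ∧ (∀ i, ¬ u i ∣ b) ∧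
      f = algebraMap A K a / algebraMap A K b * ∏ i, algebraMap A K (u i) ^ n i := by
  obtain ⟨a, b, hb₀, rfl⟩ := IsFractionRing.div_surjective (A := A) f
  have ha0 : a ≠ 0 := by rintro rfl; simp at hf
  obtain ⟨a, α, rfl, ha⟩ := exists_eq_mul_prod_pow_of_prime hu Finset.univ ha0
  obtain ⟨b, β, rfl, hb⟩ :=
    exists_eq_mul_prod_pow_of_prime hu Finset.univ (nonZeroDivisors.ne_zero hb₀)
  refine ⟨a, b, fun i => α i - β i, fun i => ha i (Finset.mem_univ i),
    fun i => hb i (Finset.mem_univ i), ?_⟩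
  have hu0 (i) : algebraMap A K (u i) ≠ 0 := algebraMap_ne_zero (hu i).ne_zero
  simp only [map_mul, map_prod, map_pow, zpow_sub₀ (hu0 _), zpow_natCast, Finset.prod_div_distrib]
  exact mul_div_mul_comm _ _ _ _

theorem exists_eq_unit_mul_prod_zpow_of_prime [IsIntegrallyClosed A] [Fintype ι] {u : ι → A}
    (hu : ∀ i, Prime (u i)) {f : K} (hf : f ≠ 0)
    (hfu : ∀ p : Ideal A, p.IsPrime → p.height = 1 → (∀ i, u i ∉ p) → IsUnitAt p f) :
    ∃ (c : Aˣ) (n : ι → ℤ), f = algebraMap A K c * ∏ i, algebraMap A K (u i) ^ n i := by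
  obtain ⟨a, b, n, ha, hb, rfl⟩ := exists_eq_div_mul_prod_zpow hu hf
  have hg0 := left_ne_zero_of_mul hf
  have hprod := right_ne_zero_of_mul hf
  suffices hg : ∀ p : Ideal A, p.IsPrime → p.height = 1 →
      IsUnitAt p (algebraMap A K a / algebraMap A K b) by
    obtain ⟨c, hc⟩ := exists_unit_eq_of_forall_isUnitAt hg0 hg
    exact ⟨c, n, by rw [hc]⟩
  intro p hp h1
  by_cases hup : ∃ i, u i ∈ p
  · obtain ⟨i, hi⟩ := hup
    have hmem (c : A) : c ∈ p ↔ u i ∣ c := by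
      rw [Ideal.eq_span_singleton_of_height_eq_one h1 hi (hu i), Ideal.mem_span_singleton]
    rw [div_eq_mul_inv]
    exact (IsUnitAt.of_notMem ((hmem a).not.2 (ha i))).mul
      ((IsUnitAt.of_notMem ((hmem b).not.2 (hb i))).inv (div_ne_zero_iff.1 hg0).2)
  · push Not at hup
    have hu0 (i) : algebraMap A K (u i) ≠ 0 := algebraMap_ne_zero (hu i).ne_zero
    have hmon : IsUnitAt p (∏ i, algebraMap A K (u i) ^ n i) :=
      IsUnitAt.prod fun i _ => (IsUnitAt.of_notMem (hup i)).zpow (hu0 i) (n i)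
    simpa only [mul_inv_cancel_right₀ hprod] using (hfu p hp h1 hup).mul (hmon.inv hprod)

end DivisorOfFunction

end Normality

section Derivations

open IsLocalRing KaehlerDifferential

theorem derivation_apply_mem_of_mem_span {R A M ι : Type*} [CommRing R] [CommRing A] [Algebra R A]
    [AddCommGroup M] [Module A M] [Module R M] (D : Derivation R A M) {t : ι → A} {a : A}
    (ha : a ∈ Ideal.span (Set.range t)) :
    D a ∈ Submodule.span A (Set.range fun i => D (t i)) ⊔
      Ideal.span (Set.range t) • (⊤ : Submodule A M) := by
  induction ha using Submodule.span_induction with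
  | mem _ h =>
    obtain ⟨i, rfl⟩ := h
    exact Submodule.mem_sup_left (Submodule.subset_span ⟨i, rfl⟩)
  | zero => simp only [map_zero, zero_mem]
  | add b c _ _ hb hc => simpa only [map_add] using add_mem hb hc
  | smul r b hb hDb =>
    rw [smul_eq_mul, Derivation.leibniz]
    exact add_mem (Submodule.smul_mem _ _ hDb)
      (Submodule.mem_sup_right (Submodule.smul_mem_smul hb trivial))

section LocalRing

variable {k A M ι : Type*} [Field k] [CommRing A] [IsLocalRing A] [Algebra k A]
  [AddCommGroup M] [Module A M] [Module k M]

-- If `P` is the minimal polynomial of the residue of `a`, then `P(a) ∈ 𝔪` and `P'(a)` is a unit,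
-- so that `D a = P'(a)⁻¹ • D (P(a))`.
theorem derivation_apply_mem_of_forall_mem_maximalIdeal
    [Algebra.IsSeparable k (ResidueField A)] (D : Derivation k A M) {Q : Submodule A M}
    (hQ : ∀ a ∈ maximalIdeal A, D a ∈ Q) (a : A) : D a ∈ Q := by
  have hres (p : Polynomial k) :
      residue A (Polynomial.aeval a p) = Polynomial.aeval (residue A a) p := by
    rw [← ResidueField.algebraMap_eq, Polynomial.aeval_algebraMap_apply]
  let P := minpoly k (residue A a)
  have hP : Polynomial.aeval a P ∈ maximalIdeal A := by
    rw [← residue_eq_zero_iff, hres, minpoly.aeval]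
  have hP' : IsUnit (Polynomial.aeval a P.derivative) := by
    rw [← residue_ne_zero_iff_isUnit, hres]
    exact (Algebra.IsSeparable.isSeparable k (residue A a)).aeval_derivative_ne_zero
      (minpoly.aeval k _)
  have hDP := hQ _ hP
  rw [Derivation.map_aeval] at hDP
  exact (Submodule.smul_mem_iff_of_isUnit _ hP').1 hDP

theorem ideal_span_range_eq_maximalIdeal [IsNoetherianRing A] {t : ι → maximalIdeal A}
    (ht : Submodule.span (ResidueField A)
      (Set.range fun i => ((maximalIdeal A).toCotangent (t i) : CotangentSpace A)) = ⊤) :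
    Ideal.span (Set.range fun i => (t i : A)) = maximalIdeal A := by
  rw [Set.range_comp' (maximalIdeal A).toCotangent t, CotangentSpace.span_image_eq_top_iff] at ht
  rw [Set.range_comp' Subtype.val t]
  refine (Submodule.map_span (maximalIdeal A).subtype _).symm.trans ?_
  rw [ht, Submodule.map_subtype_top]

variable [Algebra.EssFiniteType k A] [Algebra.IsSeparable k (ResidueField A)]
  {t : ι → maximalIdeal A}

theorem span_range_kaehlerDifferential_D_eq_top
    (ht : Ideal.span (Set.range fun i => (t i : A)) = maximalIdeal A) :
    Submodule.span A (Set.range fun i => D k A (t i)) = ⊤ := by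
  have hm (b : A) (hb : b ∈ maximalIdeal A) : D k A b ∈
      Submodule.span A (Set.range fun i => D k A (t i)) ⊔
        maximalIdeal A • (⊤ : Submodule A Ω[A⁄k]) := by
    have hDb := derivation_apply_mem_of_mem_span (D k A) (t := fun i => (t i : A)) (ht.ge hb)
    rwa [ht] at hDb
  have hD (a : A) : D k A a ∈ Submodule.span A (Set.range fun i => D k A (t i)) ⊔
      maximalIdeal A • (⊤ : Submodule A Ω[A⁄k]) :=
    derivation_apply_mem_of_forall_mem_maximalIdeal _ hm a
  refine top_le_iff.1 (Submodule.le_of_le_smul_of_le_jacobson_bot (I := maximalIdeal A)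
    Module.Finite.fg_top (jacobson_eq_maximalIdeal _ bot_ne_top).ge
    ((span_range_derivation k A).ge.trans (Submodule.span_le.2 ?_)))
  rintro _ ⟨a, rfl⟩
  exact hD a

theorem derivation_apply_mem_span_range [IsScalarTower k A M] (D : Derivation k A M)
    (ht : Ideal.span (Set.range fun i => (t i : A)) = maximalIdeal A) (a : A) :
    D a ∈ Submodule.span A (Set.range fun i => D (t i)) := by
  have ha : KaehlerDifferential.D k A a ∈
      Submodule.span A (Set.range fun i => KaehlerDifferential.D k A (t i)) :=
    span_range_kaehlerDifferential_D_eq_top (k := k) ht ▸ Submodule.mem_top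
  have hDa := Submodule.mem_map_of_mem (f := D.liftKaehlerDifferential) ha
  rw [Submodule.map_span, ← Set.range_comp] at hDa
  simpa only [Function.comp_def, Derivation.liftKaehlerDifferential_comp_D] using hDa

end LocalRing

end Derivations

section LogDifferentials

/-- The logarithmic differential `D f / f` of a field element `f`, for any derivation `D`. -/
def logDifferential {R K M : Type*} [CommRing R] [Field K] [Algebra R K] [AddCommGroup M]
    [Module K M] [Module R M] (D : Derivation R K M) (f : K) : M :=
  f⁻¹ • D f

section Field

variable {R K M : Type*} [CommRing R] [Field K] [Algebra R K] [AddCommGroup M] [Module K M]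
  [Module R M] (D : Derivation R K M) {f g : K}

theorem smul_logDifferential (hf : f ≠ 0) : f • logDifferential D f = D f := by
  rw [logDifferential, smul_inv_smul₀ hf]

theorem logDifferential_mul (hf : f ≠ 0) (hg : g ≠ 0) :
    logDifferential D (f * g) = logDifferential D f + logDifferential D g := by
  simp only [logDifferential, Derivation.leibniz, smul_add, smul_smul]
  rw [add_comm]
  congr 2 <;> field_simp

theorem logDifferential_zpow (hf : f ≠ 0) (n : ℤ) :
    logDifferential D (f ^ n) = n • logDifferential D f := by
  rw [logDifferential, Derivation.leibniz_zpow, smul_comm, smul_smul, zpow_sub_one₀ hf,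
    inv_mul_cancel_left₀ (zpow_ne_zero n hf), logDifferential]

theorem logDifferential_pow (hf : f ≠ 0) (n : ℕ) :
    logDifferential D (f ^ n) = n • logDifferential D f := by
  rw [← zpow_natCast, logDifferential_zpow D hf, natCast_zsmul]

theorem logDifferential_prod {ι : Type*} {s : Finset ι} {f : ι → K} (hf : ∀ i ∈ s, f i ≠ 0) :
    logDifferential D (∏ i ∈ s, f i) = ∑ i ∈ s, logDifferential D (f i) := by
  classical
  induction s using Finset.induction_on with
  | empty => simp [logDifferential]
  | insert i s hi ih =>
    have hs : ∀ j ∈ s, f j ≠ 0 := fun j hj => hf j (Finset.mem_insert_of_mem hj)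
    rw [Finset.prod_insert hi, Finset.sum_insert hi, logDifferential_mul D
      (hf i (Finset.mem_insert_self i s)) (Finset.prod_ne_zero_iff.2 hs), ih hs]

end Field

section Submodules

variable {R A K M ι : Type*} [CommRing R] [CommRing A] [Field K] [Algebra R K] [AddCommGroup M]
  [Module K M] [Module R M] [Module A M] {D : Derivation R K M} {Q : Submodule A M}

theorem logDifferential_mem_of_mul_pow_mem {c f : K} (hc : c ≠ 0) (hf : f ≠ 0) {n : ℕ}
    (hn : IsUnit (n : A)) (hcQ : logDifferential D c ∈ Q)
    (h : logDifferential D (c * f ^ n) ∈ Q) : logDifferential D f ∈ Q := by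
  rw [logDifferential_mul D hc (pow_ne_zero n hf), Q.add_mem_iff_right hcQ,
    logDifferential_pow D hf, ← Nat.cast_smul_eq_nsmul A] at h
  exact (Submodule.smul_mem_iff_of_isUnit _ hn).1 h

theorem logDifferential_prod_zpow_mem [Fintype ι] {f : ι → K} (hf : ∀ i, f i ≠ 0)
    (hfQ : ∀ i, logDifferential D (f i) ∈ Q) (n : ι → ℤ) :
    logDifferential D (∏ i, f i ^ n i) ∈ Q := by
  rw [logDifferential_prod D fun i _ => zpow_ne_zero (n i) (hf i)]
  refine sum_mem fun i _ => ?_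
  rw [logDifferential_zpow D (hf i)]
  exact zsmul_mem (hfQ i) (n i)

theorem logDifferential_mem_of_prod_pow_mul_mem [Fintype ι] {f : ι → K} (hf : ∀ i, f i ≠ 0)
    (hfQ : ∀ i, logDifferential D (f i) ∈ Q) {n : ι → ℕ} {g : K} (hg : g ≠ 0)
    (h : logDifferential D ((∏ i, f i ^ n i) * g) ∈ Q) : logDifferential D g ∈ Q := by
  have hprod : logDifferential D (∏ i, f i ^ n i) ∈ Q := by
    simpa only [zpow_natCast] using logDifferential_prod_zpow_mem hf hfQ fun i => n i
  rwa [logDifferential_mul D (Finset.prod_ne_zero_iff.2 fun i _ => pow_ne_zero _ (hf i)) hg,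
    Q.add_mem_iff_right hprod] at h

end Submodules

section LocalRing

open IsLocalRing

variable {k A K M τ ι κ : Type*} [Field k] [CommRing A] [IsLocalRing A] [Algebra k A]
  [Algebra.EssFiniteType k A] [Algebra.IsSeparable k (ResidueField A)] [Field K] [Algebra A K]
  [FaithfulSMul A K] [Algebra k K] [IsScalarTower k A K] [AddCommGroup M] [Module K M] [Module A M]
  [Module k M] [IsScalarTower A K M] [IsScalarTower k A M] (D : Derivation k K M)

theorem derivation_algebraMap_mem_smul_span_logDifferential {t : τ → maximalIdeal A}
    (ht : Ideal.span (Set.range fun i => (t i : A)) = maximalIdeal A) (ht0 : ∀ i, (t i : A) ≠ 0)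
    (a : A) : D (algebraMap A K a) ∈ maximalIdeal A •
      Submodule.span A (Set.range fun i => logDifferential D (algebraMap A K (t i))) := by
  refine Submodule.span_le.2 ?_ (derivation_apply_mem_span_range (D.compAlgebraMap A) ht a)
  rintro _ ⟨i, rfl⟩
  simp only [Derivation.compAlgebraMap_apply]
  rw [← smul_logDifferential D (algebraMap_ne_zero (ht0 i)), algebraMap_smul]
  exact Submodule.smul_mem_smul (t i).2 (Submodule.subset_span ⟨i, rfl⟩)

theorem logDifferential_unit_mem_smul_span_logDifferential {t : τ → maximalIdeal A}
    (ht : Ideal.span (Set.range fun i => (t i : A)) = maximalIdeal A) (ht0 : ∀ i, (t i : A) ≠ 0)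
    (c : Aˣ) : logDifferential D (algebraMap A K c) ∈ maximalIdeal A •
      Submodule.span A (Set.range fun i => logDifferential D (algebraMap A K (t i))) := by
  rw [logDifferential, ← map_units_inv, algebraMap_smul]
  exact Submodule.smul_mem _ _
    (derivation_algebraMap_mem_smul_span_logDifferential D ht ht0 (c : A))

variable [Fintype ι] {u : ι → maximalIdeal A} {v : κ → maximalIdeal A}

theorem span_logDifferential_coordinates_le [Finite κ]
    (huv : Ideal.span (Set.range fun i => ((Sum.elim u v i : maximalIdeal A) : A)) =
      maximalIdeal A)
    (hu : ∀ i, (u i : A) ≠ 0) (hv : ∀ j, (v j : A) ≠ 0)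
    {n : ℕ} (hn : (n : k) ≠ 0) (c : ι → Aˣ) (e : κ → ι → ℕ) :
    Submodule.span A
        (Set.range fun i => logDifferential D (algebraMap A K (Sum.elim u v i : maximalIdeal A))) ≤
      Submodule.span A
        (Set.range (fun i =>
            logDifferential D (algebraMap A K (c i) * algebraMap A K (u i) ^ n)) ∪
          Set.range (fun j => logDifferential D
            ((∏ i, algebraMap A K (u i) ^ e j i) * algebraMap A K (v j)))) := by
  set L := Submodule.span A
    (Set.range fun i => logDifferential D (algebraMap A K (Sum.elim u v i : maximalIdeal A)))
  set N := Submodule.span A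
    (Set.range (fun i => logDifferential D (algebraMap A K (c i) * algebraMap A K (u i) ^ n)) ∪
      Set.range (fun j => logDifferential D
        ((∏ i, algebraMap A K (u i) ^ e j i) * algebraMap A K (v j))))
  have huv0 : ∀ i, ((Sum.elim u v i : maximalIdeal A) : A) ≠ 0 := Sum.forall.2 ⟨hu, hv⟩
  have hnA : IsUnit (n : A) := by
    simpa only [map_natCast] using hn.isUnit.map (algebraMap k A)
  have hLu (i : ι) : logDifferential D (algebraMap A K (u i)) ∈ N ⊔ maximalIdeal A • L :=
    logDifferential_mem_of_mul_pow_mem (algebraMap_ne_zero (c i).ne_zero)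
      (algebraMap_ne_zero (hu i)) hnA
      (Submodule.mem_sup_right (logDifferential_unit_mem_smul_span_logDifferential D huv huv0 _))
      (Submodule.mem_sup_left (Submodule.subset_span (Or.inl ⟨i, rfl⟩)))
  have hLv (j : κ) : logDifferential D (algebraMap A K (v j)) ∈ N ⊔ maximalIdeal A • L :=
    logDifferential_mem_of_prod_pow_mul_mem (fun i => algebraMap_ne_zero (hu i)) hLu
      (algebraMap_ne_zero (hv j))
      (Submodule.mem_sup_left (Submodule.subset_span (Or.inr ⟨j, rfl⟩)))
  refine Submodule.le_of_le_smul_of_le_jacobson_bot (Submodule.fg_span (Set.finite_range _))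
    (jacobson_eq_maximalIdeal _ bot_ne_top).ge (Submodule.span_le.2 ?_)
  rintro _ ⟨i | j, rfl⟩
  exacts [hLu i, hLv j]

theorem logDifferential_unit_mul_prod_zpow_mem
    (huv : Ideal.span (Set.range fun i => ((Sum.elim u v i : maximalIdeal A) : A)) =
      maximalIdeal A)
    (hu : ∀ i, (u i : A) ≠ 0) (hv : ∀ j, (v j : A) ≠ 0)
    (c : Aˣ) (n : ι → ℤ) :
    logDifferential D (algebraMap A K c * ∏ i, algebraMap A K (u i) ^ n i) ∈ Submodule.span A
      (Set.range fun i =>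
        logDifferential D (algebraMap A K (Sum.elim u v i : maximalIdeal A))) := by
  have huv0 : ∀ i, ((Sum.elim u v i : maximalIdeal A) : A) ≠ 0 := Sum.forall.2 ⟨hu, hv⟩
  have hu0 (i : ι) : algebraMap A K (u i) ≠ 0 := algebraMap_ne_zero (hu i)
  rw [logDifferential_mul D (algebraMap_ne_zero c.ne_zero)
    (Finset.prod_ne_zero_iff.2 fun i _ => zpow_ne_zero _ (hu0 i))]
  refine add_mem
    (Submodule.smul_le_right (logDifferential_unit_mem_smul_span_logDifferential D huv huv0 c))
    (logDifferential_prod_zpow_mem hu0 (fun i => Submodule.subset_span ?_) n)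
  exact ⟨Sum.inl i, rfl⟩

end LocalRing

end LogDifferentials

section Stalks

open IsLocalRing

theorem isLocalization_atPrime_comap_maximalIdeal {R A B : Type*} [CommRing R] [CommRing A]
    [CommRing B] [IsLocalRing B] [Algebra R A] [Algebra A B] [Algebra R B] [IsScalarTower R A B]
    (p q : Ideal R) [p.IsPrime] [q.IsPrime] [IsLocalization.AtPrime A p]
    [IsLocalization.AtPrime B q] :
    IsLocalization.AtPrime B ((maximalIdeal B).comap (algebraMap A B)) := by
  have hqp : p.primeCompl ≤ q.primeCompl := fun a ha => by
    have hu := ((IsLocalization.AtPrime.isUnit_to_map_iff A p a).2 ha).map (algebraMap A B)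
    rw [← IsScalarTower.algebraMap_apply] at hu
    exact (IsLocalization.AtPrime.isUnit_to_map_iff B q a).1 hu
  have := IsLocalization.isLocalization_of_submonoid_le A B _ _ hqp
  refine IsLocalization.of_le (q.primeCompl.map (algebraMap R A)) _ ?_ fun a ha => not_not.1 ha
  rintro _ ⟨a, ha, rfl⟩
  refine not_not.2 ?_
  rw [← IsScalarTower.algebraMap_apply]
  exact (IsLocalization.AtPrime.isUnit_to_map_iff B q a).2 ha

variable {X : Scheme.{u}}

theorem isLocalization_stalkSpecializes {z x : X} (h : z ⤳ x) :
    letI := (X.presheaf.stalkSpecializes h).hom.toAlgebra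
    IsLocalization.AtPrime (X.presheaf.stalk z)
      ((maximalIdeal (X.presheaf.stalk z)).comap (X.presheaf.stalkSpecializes h).hom) := by
  let := (X.presheaf.stalkSpecializes h).hom.toAlgebra
  obtain ⟨U, hU, hxU, -⟩ := exists_isAffineOpen_mem_and_subset (U := ⊤) (Set.mem_univ x)
  have hzU : z ∈ U := h.mem_open U.2 hxU
  let : Algebra Γ(X, U) (X.presheaf.stalk x) := X.presheaf.algebra_section_stalk ⟨x, hxU⟩
  let : Algebra Γ(X, U) (X.presheaf.stalk z) := X.presheaf.algebra_section_stalk ⟨z, hzU⟩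
  have : IsScalarTower Γ(X, U) (X.presheaf.stalk x) (X.presheaf.stalk z) :=
    .of_algebraMap_eq' congr($(X.presheaf.germ_stalkSpecializes hxU h).hom).symm
  have := hU.isLocalization_stalk ⟨x, hxU⟩
  have := hU.isLocalization_stalk ⟨z, hzU⟩
  exact isLocalization_atPrime_comap_maximalIdeal (hU.primeIdealOf ⟨x, hxU⟩).asIdeal
    (hU.primeIdealOf ⟨z, hzU⟩).asIdeal

theorem height_comap_stalkSpecializes {z x : X} (h : z ⤳ x) :
    ((maximalIdeal (X.presheaf.stalk z)).comap (X.presheaf.stalkSpecializes h).hom).height =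
      Order.coheight z := by
  let := (X.presheaf.stalkSpecializes h).hom.toAlgebra
  have := isLocalization_stalkSpecializes h
  have hdim := IsLocalization.AtPrime.ringKrullDim_eq_height
    ((maximalIdeal (X.presheaf.stalk z)).comap (X.presheaf.stalkSpecializes h).hom)
    (X.presheaf.stalk z)
  rw [ringKrullDim_stalk_eq_coheight] at hdim
  exact (WithBot.coe_injective hdim).symm

theorem exists_comap_stalkSpecializes_eq (x : X) (p : Ideal (X.presheaf.stalk x)) [hp : p.IsPrime] :
    ∃ (z : X) (h : z ⤳ x),
      (maximalIdeal (X.presheaf.stalk z)).comap (X.presheaf.stalkSpecializes h).hom = p := by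
  let y : Spec (X.presheaf.stalk x) := ⟨p, hp⟩
  have h : X.fromSpecStalk x y ⤳ x := by
    have hy := Set.mem_range_self (f := X.fromSpecStalk x) y
    rwa [Scheme.range_fromSpecStalk] at hy
  let c : Spec (X.presheaf.stalk (X.fromSpecStalk x y)) := closedPoint _
  have hc : X.fromSpecStalk x (Spec.map (X.presheaf.stalkSpecializes h) c) =
      X.fromSpecStalk x y := by
    rw [← Scheme.Hom.comp_apply, Scheme.SpecMap_stalkSpecializes_fromSpecStalk]
    exact Scheme.fromSpecStalk_closedPoint
  exact ⟨_, h, congr_arg PrimeSpectrum.asIdeal ((X.fromSpecStalk x).isEmbedding.injective hc)⟩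

variable [IsIntegral X]

theorem isIntegrallyClosed_stalk_of_specializes {z x : X} (h : z ⤳ x)
    [IsIntegrallyClosed (X.presheaf.stalk x)] : IsIntegrallyClosed (X.presheaf.stalk z) := by
  let := (X.presheaf.stalkSpecializes h).hom.toAlgebra
  have := isLocalization_stalkSpecializes h
  exact isIntegrallyClosed_of_isLocalization (X.presheaf.stalk z)
    ((maximalIdeal (X.presheaf.stalk z)).comap (X.presheaf.stalkSpecializes h).hom).primeCompl
    (Ideal.primeCompl_le_nonZeroDivisors _)

theorem algebraMap_stalkSpecializes {z x : X} (h : z ⤳ x) (t : X.presheaf.stalk x) :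
    algebraMap (X.presheaf.stalk z) X.functionField (X.presheaf.stalkSpecializes h t) =
      algebraMap (X.presheaf.stalk x) X.functionField t := by
  change (X.presheaf.stalkSpecializes h ≫ X.presheaf.stalkSpecializes _) t = _
  rw [TopCat.Presheaf.stalkSpecializes_comp]
  rfl

theorem isUnitAt_algebraMap_of_isUnit {z x : X} (h : z ⤳ x) {c : X.presheaf.stalk z}
    (hc : IsUnit c) :
    IsUnitAt ((maximalIdeal (X.presheaf.stalk z)).comap (X.presheaf.stalkSpecializes h).hom)
      (algebraMap (X.presheaf.stalk z) X.functionField c) := by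
  let := (X.presheaf.stalkSpecializes h).hom.toAlgebra
  have := isLocalization_stalkSpecializes h
  obtain ⟨⟨a, s⟩, hs⟩ := IsLocalization.surj ((maximalIdeal (X.presheaf.stalk z)).comap
    (X.presheaf.stalkSpecializes h).hom).primeCompl c
  refine ⟨a, not_not.2 ?_, s, s.2, ?_⟩
  · exact hs ▸ hc.mul (IsLocalization.map_units _ s)
  · rw [← algebraMap_stalkSpecializes h, ← algebraMap_stalkSpecializes h, mul_comm, ← map_mul]
    exact congr_arg _ hs

theorem exists_isUnit_of_ord_eq_zero [IsLocallyNoetherian X] {z : X}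
    [IsIntegrallyClosed (X.presheaf.stalk z)] (hz : Order.coheight z = 1) {f : X.functionField}
    (hf : f ≠ 0) (h : X.ord f z = 0) :
    ∃ c : X.presheaf.stalk z, IsUnit c ∧ algebraMap (X.presheaf.stalk z) X.functionField c = f := by
  have : Ring.KrullDimLE 1 (X.presheaf.stalk z) := krullDimLE_of_coheight_le hz.le
  have hfield : ¬ IsField (X.presheaf.stalk z) := fun hF => by
    have hdim := ringKrullDim_eq_zero_of_isField hF
    rw [ringKrullDim_stalk_eq_coheight, hz] at hdim
    exact one_ne_zero (WithBot.coe_injective hdim)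
  have : IsDedekindDomain (X.presheaf.stalk z) :=
    { maximalOfPrime := fun h0 hp => hp.isMaximal_of_ne_bot h0 }
  have : IsDiscreteValuationRing (X.presheaf.stalk z) :=
    ((IsDiscreteValuationRing.TFAE _ hfield).out 2 0).1 this
  rw [Scheme.ord_eq_iff hz hf] at h
  have hker : f ∈ MonoidHom.mker (Ring.ordFrac (X.presheaf.stalk z) (K := X.functionField)) := h
  rwa [Ring.mker_ordFrac_eq_isUnitSubmonoid] at hker

theorem isUnitAt_of_ord_eq_zero [IsLocallyNoetherian X] {z x : X} (h : z ⤳ x)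
    [IsIntegrallyClosed (X.presheaf.stalk x)] (hz : Order.coheight z = 1) {f : X.functionField}
    (hf : f ≠ 0) (hord : X.ord f z = 0) :
    IsUnitAt ((maximalIdeal (X.presheaf.stalk z)).comap (X.presheaf.stalkSpecializes h).hom) f := by
  have := isIntegrallyClosed_stalk_of_specializes h
  obtain ⟨c, hc, rfl⟩ := exists_isUnit_of_ord_eq_zero hz hf hord
  exact isUnitAt_algebraMap_of_isUnit h hc

end Stalks

section Components

variable {T : Type*} [TopologicalSpace T] {Y : Set T}

theorem isClosed_of_mem_componentsOf {Z : Set T} (hY : IsClosed Y) (hZ : Z ∈ componentsOf Y) :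
    IsClosed Z :=
  isClosed_of_closure_subset
    (hZ.2 ⟨hZ.1.1.closure, hY.closure_subset_iff.2 hZ.1.2⟩ subset_closure)

theorem exists_mem_componentsOf {z : T} (hz : z ∈ Y) : ∃ Z ∈ componentsOf Y, z ∈ Z := by
  refine ⟨(↑) '' irreducibleComponent (⟨z, hz⟩ : Y),
    ⟨⟨isIrreducible_irreducibleComponent.image _ continuous_subtype_val.continuousOn,
      Subtype.coe_image_subset _ _⟩, ?_⟩, ⟨z, hz⟩, mem_irreducibleComponent, rfl⟩
  rintro S ⟨hS, hSY⟩ hCS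
  have hpre : IsPreirreducible ((↑) ⁻¹' S : Set Y) := by
    rintro _ _ ⟨U, hU, rfl⟩ ⟨V, hV, rfl⟩ ⟨a, haS, haU⟩ ⟨b, hbS, hbV⟩
    obtain ⟨t, htS, htUV⟩ := hS.2 U V hU hV ⟨a, haS, haU⟩ ⟨b, hbS, hbV⟩
    exact ⟨⟨t, hSY htS⟩, htS, htUV⟩
  rw [← eq_irreducibleComponent hpre (Set.image_subset_iff.1 hCS)]
  exact fun y hy => ⟨⟨y, hSY hy⟩, hy, rfl⟩

variable {X : Scheme.{u}}

theorem comap_stalkSpecializes_le_of_specializes {y z x : X} (hyz : y ⤳ z) (hzx : z ⤳ x) :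
    (IsLocalRing.maximalIdeal (X.presheaf.stalk y)).comap
        (X.presheaf.stalkSpecializes (hyz.trans hzx)).hom ≤
      (IsLocalRing.maximalIdeal (X.presheaf.stalk z)).comap
        (X.presheaf.stalkSpecializes hzx).hom := by
  intro a ha hu
  refine ha ?_
  have huy := hu.map (X.presheaf.stalkSpecializes hyz).hom
  rwa [← CommRingCat.comp_apply, TopCat.Presheaf.stalkSpecializes_comp] at huy

theorem isPrime_vanishingIdealAt {Z : Set X} (hZ : IsClosed Z) (hirr : IsIrreducible Z) {x : X}
    (hx : x ∈ Z) : (vanishingIdealAt Z x).IsPrime := by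
  obtain ⟨η, hη⟩ := QuasiSober.sober hirr hZ
  have hηx : η ⤳ x := hη.specializes hx
  have hideal : vanishingIdealAt Z x = (IsLocalRing.maximalIdeal (X.presheaf.stalk η)).comap
      (X.presheaf.stalkSpecializes hηx).hom :=
    le_antisymm (iInf_le _ (⟨η, hη.mem, hηx⟩ : {z : X // z ∈ Z ∧ z ⤳ x})) (le_iInf fun z =>
      comap_stalkSpecializes_le_of_specializes (hη.specializes z.2.1) z.2.2)
  rw [hideal]
  infer_instance

end Components

namespace GVariety

section Stalks

open IsLocalRing

variable {k : Type u} [Field k] {G : Type v} [Group G] (V : GVariety k G)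

/-- The local rings of `X` as `k`-algebras. At the generic point this is the `k`-algebra structure
of the function field, hence the low priority. -/
noncomputable instance (priority := low) stalkAlgebra (x : V.X) :
    Algebra k (V.X.presheaf.stalk x) :=
  ((Scheme.ΓSpecIso (.of k)).inv ≫ V.π.appTop ≫ V.X.presheaf.germ ⊤ x trivial).hom.toAlgebra

/-- The rings of sections of `X` over open subsets as `k`-algebras. -/
noncomputable instance sectionAlgebra (U : V.X.Opens) : Algebra k Γ(V.X, U) :=
  ((Scheme.ΓSpecIso (.of k)).inv ≫ V.π.appLE ⊤ U le_top).hom.toAlgebra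

instance isScalarTower_stalk_functionField (x : V.X) :
    IsScalarTower k (V.X.presheaf.stalk x) V.X.functionField := by
  refine .of_algebraMap_eq' ?_
  change _ = (((Scheme.ΓSpecIso (.of k)).inv ≫ V.π.appTop ≫ V.X.presheaf.germ ⊤ x trivial) ≫
    V.X.presheaf.stalkSpecializes ((genericPoint_spec V.X).specializes trivial)).hom
  have hgerm := V.X.presheaf.germ_stalkSpecializes (U := ⊤) (y := x) trivial
    ((genericPoint_spec V.X).specializes trivial)
  rw [Category.assoc, Category.assoc, hgerm]
  rfl

theorem isScalarTower_section_stalk {U : V.X.Opens} (x : U) :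
    IsScalarTower k Γ(V.X, U) (V.X.presheaf.stalk x.1) := by
  refine .of_algebraMap_eq' ?_
  change _ = (((Scheme.ΓSpecIso (.of k)).inv ≫ V.π.appLE ⊤ U le_top) ≫
    V.X.presheaf.germ U x.1 x.2).hom
  have hgerm : V.π.appLE ⊤ U le_top ≫ V.X.presheaf.germ U x.1 x.2 =
      V.π.appTop ≫ V.X.presheaf.germ ⊤ x.1 trivial := by
    simp only [Scheme.Hom.appLE, Category.assoc]
    rw [TopCat.Presheaf.germ_res]
    rfl
  rw [Category.assoc, hgerm]
  rfl

theorem finiteType_section {U : V.X.Opens} (hU : IsAffineOpen U) :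
    Algebra.FiniteType k Γ(V.X, U) :=
  (V.π.finiteType_appLE (isAffineOpen_top _) hU le_top).comp
    (RingHom.FiniteType.of_surjective (Scheme.ΓSpecIso (.of k)).inv.hom
      (ConcreteCategory.bijective_of_isIso (Scheme.ΓSpecIso (.of k)).inv).2)

theorem smooth_section [Smooth V.π] {U : V.X.Opens} (hU : IsAffineOpen U) :
    Algebra.Smooth k Γ(V.X, U) :=
  (RingHom.Smooth.of_bijective (f := (Scheme.ΓSpecIso (.of k)).inv.hom)
    (ConcreteCategory.bijective_of_isIso (Scheme.ΓSpecIso (.of k)).inv)).comp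
      (V.π.smooth_appLE (isAffineOpen_top _) hU le_top)

instance essFiniteType_stalk (x : V.X) : Algebra.EssFiniteType k (V.X.presheaf.stalk x) := by
  obtain ⟨U, hU, hxU, -⟩ := exists_isAffineOpen_mem_and_subset (U := ⊤) (Set.mem_univ x)
  let : Algebra Γ(V.X, U) (V.X.presheaf.stalk x) := V.X.presheaf.algebra_section_stalk ⟨x, hxU⟩
  have := V.isScalarTower_section_stalk ⟨x, hxU⟩
  have := V.finiteType_section hU
  have := hU.isLocalization_stalk ⟨x, hxU⟩
  have : Algebra.EssFiniteType Γ(V.X, U) (V.X.presheaf.stalk x) :=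
    .of_isLocalization _ (hU.primeIdealOf ⟨x, hxU⟩).asIdeal.primeCompl
  exact .comp k Γ(V.X, U) (V.X.presheaf.stalk x)

theorem isIntegrallyClosed_stalk [Smooth V.π] (x : V.X) :
    IsIntegrallyClosed (V.X.presheaf.stalk x) := by
  obtain ⟨U, hU, hxU, -⟩ := exists_isAffineOpen_mem_and_subset (U := ⊤) (Set.mem_univ x)
  let : Algebra Γ(V.X, U) (V.X.presheaf.stalk x) := V.X.presheaf.algebra_section_stalk ⟨x, hxU⟩
  have := V.smooth_section hU
  have := hU.isLocalization_stalk ⟨x, hxU⟩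
  have : Nonempty U := ⟨⟨x, hxU⟩⟩
  have := isIntegrallyClosed_of_smooth k Γ(V.X, U)
  exact isIntegrallyClosed_of_isLocalization (V.X.presheaf.stalk x)
    (hU.primeIdealOf ⟨x, hxU⟩).asIdeal.primeCompl (Ideal.primeCompl_le_nonZeroDivisors _)

theorem isAlgebraic_residueField {x : V.X} (hx : IsClosed ({x} : Set V.X)) :
    Algebra.IsAlgebraic k (ResidueField (V.X.presheaf.stalk x)) := by
  obtain ⟨U, hU, hxU, -⟩ := exists_isAffineOpen_mem_and_subset (U := ⊤) (Set.mem_univ x)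
  let : Algebra Γ(V.X, U) (V.X.presheaf.stalk x) := V.X.presheaf.algebra_section_stalk ⟨x, hxU⟩
  have := V.isScalarTower_section_stalk ⟨x, hxU⟩
  have := V.finiteType_section hU
  have := hU.isLocalization_stalk ⟨x, hxU⟩
  let q := (hU.primeIdealOf ⟨x, hxU⟩).asIdeal
  have : q.IsMaximal := hU.primeIdealOf_isMaximal_of_isClosed ⟨x, hxU⟩ hx
  have hsurj :
      Function.Surjective (algebraMap Γ(V.X, U) (ResidueField (V.X.presheaf.stalk x))) := by
    intro y
    obtain ⟨r, rfl⟩ := (IsLocalization.AtPrime.equivQuotMaximalIdeal q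
      (V.X.presheaf.stalk x)).surjective y
    obtain ⟨s, rfl⟩ := Ideal.Quotient.mk_surjective r
    exact ⟨s, rfl⟩
  have : Algebra.FiniteType k (ResidueField (V.X.presheaf.stalk x)) :=
    .of_surjective (IsScalarTower.toAlgHom k Γ(V.X, U) _) hsurj
  have := finite_of_finite_type_of_isJacobsonRing k (ResidueField (V.X.presheaf.stalk x))
  infer_instance

end Stalks

end GVariety

section GermPullback

open IsLocalRing

variable {X : Scheme.{u}}

theorem germPullback_congr {φ ψ : X ⟶ X} (e : φ = ψ) {x y : X} (h : φ x = y) (h' : ψ x = y) :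
    germPullback φ h = germPullback ψ h' := by
  subst e; rfl

theorem germPullback_germPullback (φ ψ : X ⟶ X) {x y z : X} (h : φ x = y) (h' : ψ y = z)
    (h'' : (φ ≫ ψ) x = z) (t : X.presheaf.stalk z) :
    germPullback φ h (germPullback ψ h' t) = germPullback (φ ≫ ψ) h'' t := by
  subst h h'
  simp only [germPullback, ← CommRingCat.comp_apply]
  simp [Scheme.Hom.stalkMap_comp]

theorem germPullback_id {x : X} (h : (𝟙 X : X ⟶ X) x = x) (t : X.presheaf.stalk x) :
    germPullback (𝟙 X) h t = t := by
  simp [germPullback]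

theorem stalkSpecializes_germPullback (φ : X ⟶ X) {z x w y : X} (h : φ x = y) (hw : φ z = w)
    (hzx : z ⤳ x) (hwy : w ⤳ y) (t : X.presheaf.stalk y) :
    X.presheaf.stalkSpecializes hzx (germPullback φ h t) =
      germPullback φ hw (X.presheaf.stalkSpecializes hwy t) := by
  subst h hw
  simp only [germPullback, ← CommRingCat.comp_apply]
  congr 2
  rw [Category.assoc, ← Scheme.Hom.stalkSpecializes_stalkMap,
    TopCat.Presheaf.stalkSpecializes_comp_assoc, TopCat.Presheaf.stalkSpecializes_comp_assoc]

theorem germPullback_bijective (φ : X ⟶ X) [IsIso φ] {x y : X} (h : φ x = y) :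
    Function.Bijective (germPullback φ h) := by
  subst h
  have : IsIso (X.presheaf.stalkSpecializes (specializes_of_eq (rfl : φ x = φ x)) ≫
      φ.stalkMap x) := by
    rw [TopCat.Presheaf.stalkSpecializes_refl]
    infer_instance
  exact ConcreteCategory.bijective_of_isIso _

theorem germPullback_mem_maximalIdeal_iff (φ : X ⟶ X) [IsIso φ] {x y : X} (h : φ x = y)
    (t : X.presheaf.stalk y) :
    germPullback φ h t ∈ maximalIdeal (X.presheaf.stalk x) ↔
      t ∈ maximalIdeal (X.presheaf.stalk y) :=
  not_congr (MulEquiv.isUnit_map (RingEquiv.ofBijective _ (germPullback_bijective φ h)))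

theorem mem_vanishingIdealAt_image_iff (φ : X ⟶ X) [IsIso φ] {x y : X} (h : φ x = y) (Z : Set X)
    (t : X.presheaf.stalk y) :
    t ∈ vanishingIdealAt (φ '' Z) y ↔ germPullback φ h t ∈ vanishingIdealAt Z x := by
  have hspec (z : X) : φ z ⤳ y ↔ z ⤳ x := h ▸ φ.isOpenEmbedding.isInducing.specializes_iff
  have hmem (z : X) (hzx : z ⤳ x) (hzy : φ z ⤳ y) :
      X.presheaf.stalkSpecializes hzy t ∈ maximalIdeal (X.presheaf.stalk (φ z)) ↔
        X.presheaf.stalkSpecializes hzx (germPullback φ h t) ∈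
          maximalIdeal (X.presheaf.stalk z) := by
    rw [stalkSpecializes_germPullback φ h rfl hzx hzy, germPullback_mem_maximalIdeal_iff]
  simp only [vanishingIdealAt, Ideal.mem_iInf, Ideal.mem_comap, Subtype.forall]
  constructor
  · rintro H z ⟨hz, hzx⟩
    exact (hmem z hzx ((hspec z).2 hzx)).1 (H (φ z) ⟨⟨z, hz, rfl⟩, (hspec z).2 hzx⟩)
  · rintro H _ ⟨⟨z, hz, rfl⟩, hzy⟩
    exact (hmem z ((hspec z).1 hzy) hzy).2 (H z ⟨hz, (hspec z).1 hzy⟩)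

theorem span_germPullback_eq_vanishingIdealAt (φ : X ⟶ X) [IsIso φ] {x y : X} (h : φ x = y)
    {Z : Set X} {t : X.presheaf.stalk y} (ht : Ideal.span {t} = vanishingIdealAt (φ '' Z) y) :
    Ideal.span {germPullback φ h t} = vanishingIdealAt Z x := by
  ext a
  obtain ⟨b, rfl⟩ := (germPullback_bijective φ h).2 a
  rw [← mem_vanishingIdealAt_image_iff, ← ht, Ideal.mem_span_singleton, Ideal.mem_span_singleton]
  exact map_dvd_iff (RingEquiv.ofBijective _ (germPullback_bijective φ h))

end GermPullback

theorem mem_span_range_algebraMap_of_mem_span {A K M : Type*} [CommRing A] [CommRing K]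
    [Algebra A K] [AddCommGroup M] [Module A M] [Module K M] [IsScalarTower A K M] {s : Set M}
    {ω : M} (h : ω ∈ Submodule.span A s) : ω ∈ Submodule.span (algebraMap A K).range s := by
  induction h using Submodule.span_induction with
  | mem ω hω => exact Submodule.subset_span hω
  | zero => exact zero_mem _
  | add a b _ _ ha hb => exact add_mem ha hb
  | smul a ω _ hω =>
    rw [← algebraMap_smul K a ω]
    exact Submodule.smul_mem _ (⟨algebraMap A K a, a, rfl⟩ : (algebraMap A K).range) hω

theorem IsLocalCoordinateSystem.ne_zero {X : Scheme.{u}} {x : X} {ι : Type*}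
    {t : ι → IsLocalRing.maximalIdeal (X.presheaf.stalk x)} (ht : IsLocalCoordinateSystem x t)
    (i : ι) : (t i : X.presheaf.stalk x) ≠ 0 := by
  refine fun h => ht.1.ne_zero i ?_
  rw [show t i = 0 from Subtype.ext h, map_zero]

namespace GVariety

open IsLocalRing

variable {k : Type u} [Field k] {G : Type v} [Group G] (V : GVariety k G)

section RationalFunctions

theorem act_mul_hom (g h : G) : (V.act (g * h)).hom = (V.act h).hom ≫ (V.act g).hom := by
  rw [map_mul]; rfl

theorem act_one_hom : (V.act 1).hom = 𝟙 V.X := by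
  rw [map_one]; rfl

theorem ratPullback_ratPullback (g h : G) (f : V.X.functionField) :
    V.ratPullback h (V.ratPullback g f) = V.ratPullback (g * h) f := by
  have hgh := V.act_mul_hom g h
  refine (germPullback_germPullback _ _ _ _ ?_ f).trans ?_
  · exact hgh ▸ genericPoint_eq_of_isOpenImmersion _
  · exact congr($(germPullback_congr hgh.symm _ _) f)

theorem ratPullback_one (f : V.X.functionField) : V.ratPullback 1 f = f :=
  congr($(germPullback_congr V.act_one_hom _ (by simp)) f).trans (germPullback_id _ f)

theorem toRat_germPullback (g : G) {x y : V.X} (h : (V.act g).hom x = y)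
    (t : V.X.presheaf.stalk y) :
    V.toRat x (germPullback (V.act g).hom h t) = V.ratPullback g (V.toRat y t) :=
  stalkSpecializes_germPullback _ _ _ _ _ t

theorem toRat_injective (x : V.X) : Function.Injective (V.toRat x) :=
  IsFractionRing.injective (V.X.presheaf.stalk x) V.X.functionField

theorem toRat_ne_zero {x : V.X} {t : V.X.presheaf.stalk x} (ht : t ≠ 0) : V.toRat x t ≠ 0 :=
  (map_ne_zero_iff _ (V.toRat_injective x)).2 ht

end RationalFunctions

section Coordinates

variable {V} {Y : Set V.X} {x : V.X} {m l : ℕ} {Z : Set V.X} {Ys : Fin m → Set V.X}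
  {u : Fin m → maximalIdeal (V.X.presheaf.stalk x)}
  {v : Fin l → maximalIdeal (V.X.presheaf.stalk x)} {t : V.X.presheaf.stalk x}

theorem IsLocalEquation.exists_ratPullback_eq {r : V.X.functionField} {g : G}
    (hr : V.IsLocalEquation r ((V.act g).hom '' Z) ((V.act g).hom x)) :
    ∃ s : V.X.presheaf.stalk x, V.toRat x s = V.ratPullback g r ∧
      Ideal.span {s} = vanishingIdealAt Z x := by
  obtain ⟨t, rfl, ht⟩ := hr
  exact ⟨germPullback (V.act g).hom rfl t, V.toRat_germPullback g rfl t,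
    span_germPullback_eq_vanishingIdealAt _ _ ht⟩

theorem span_eq_vanishingIdealAt_of_isLocalEquation
    (ht : V.IsLocalEquation (V.toRat x t) ((V.act 1).hom '' Z) ((V.act 1).hom x)) :
    Ideal.span {t} = vanishingIdealAt Z x := by
  obtain ⟨s, hs, hsZ⟩ := ht.exists_ratPullback_eq
  rw [ratPullback_one] at hs
  rwa [V.toRat_injective x hs] at hsZ

theorem exists_ratPullback_eq_unit_mul
    (ht : ∀ g : G, V.IsLocalEquation (V.toRat x t) ((V.act g).hom '' Z) ((V.act g).hom x))
    (g : G) : ∃ c : (V.X.presheaf.stalk x)ˣ,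
      V.ratPullback g (V.toRat x t) = V.toRat x c * V.toRat x t := by
  obtain ⟨s, hs, hsZ⟩ := (ht g).exists_ratPullback_eq
  rw [← span_eq_vanishingIdealAt_of_isLocalEquation (ht 1),
    Ideal.span_singleton_eq_span_singleton] at hsZ
  obtain ⟨c, hc⟩ := hsZ.symm
  exact ⟨c, by rw [← hs, ← hc, map_mul, mul_comm]⟩

theorem exists_wFun_eq_unit_mul_pow [Fintype G] {i : Fin m}
    (hu : ∀ g : G, V.IsLocalEquation (V.toRat x (u i)) ((V.act g).hom '' Z) ((V.act g).hom x)) :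
    ∃ c : (V.X.presheaf.stalk x)ˣ,
      V.wFun u i = V.toRat x c * V.toRat x (u i) ^ Fintype.card G := by
  choose c hc using exists_ratPullback_eq_unit_mul hu
  refine ⟨∏ g, c g, ?_⟩
  rw [wFun, Finset.prod_congr rfl fun g _ => hc g, Finset.prod_mul_distrib, Finset.prod_const,
    Finset.card_univ, Units.coe_prod, map_prod]

theorem wFun_ne_zero [Fintype G] {i : Fin m} (hu : (u i : V.X.presheaf.stalk x) ≠ 0) :
    V.wFun u i ≠ 0 :=
  Finset.prod_ne_zero_iff.2 fun _ _ => (map_ne_zero _).2 (V.toRat_ne_zero hu)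

theorem ratPullback_wFun [Fintype G] (i : Fin m) (g : G) :
    V.ratPullback g (V.wFun u i) = V.wFun u i := by
  rw [wFun, map_prod]
  simp only [ratPullback_ratPullback]
  exact Fintype.prod_equiv (Equiv.mulRight g) _ _ fun _ => rfl

theorem hFun_ne_zero (hu : ∀ i, (u i : V.X.presheaf.stalk x) ≠ 0) {j : Fin l}
    (hv : (v j : V.X.presheaf.stalk x) ≠ 0) (e : Fin l → Fin m → ℕ) : V.hFun u v e j ≠ 0 :=
  mul_ne_zero (Finset.prod_ne_zero_iff.2 fun i _ => pow_ne_zero _ (V.toRat_ne_zero (hu i)))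
    (V.toRat_ne_zero hv)

theorem prime_of_span_eq_vanishingIdealAt (hY : IsClosed Y) (hZ : Z ∈ componentsOf Y) (hxZ : x ∈ Z)
    (ht0 : t ≠ 0) (ht : Ideal.span {t} = vanishingIdealAt Z x) : Prime t := by
  rw [← Ideal.span_singleton_prime ht0, ht]
  exact isPrime_vanishingIdealAt (isClosed_of_mem_componentsOf hY hZ) hZ.1.1 hxZ

theorem DivisorSupportedOn.exists_eq_unit_mul_prod_zpow [IsIntegrallyClosed (V.X.presheaf.stalk x)]
    {f : V.X.functionField} (hfY : V.DivisorSupportedOn f Y) (hf : f ≠ 0) (hY : IsClosed Y)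
    (hYs : Set.range Ys = {Z | Z ∈ componentsOf Y ∧ x ∈ Z})
    (hu0 : ∀ i, (u i : V.X.presheaf.stalk x) ≠ 0)
    (hu : ∀ i, Ideal.span {(u i : V.X.presheaf.stalk x)} = vanishingIdealAt (Ys i) x) :
    ∃ (c : (V.X.presheaf.stalk x)ˣ) (n : Fin m → ℤ),
      f = V.toRat x c * ∏ i, V.toRat x (u i) ^ n i := by
  have hprime (i : Fin m) : Prime (u i : V.X.presheaf.stalk x) := by
    obtain ⟨hZ, hxZ⟩ : Ys i ∈ {Z | Z ∈ componentsOf Y ∧ x ∈ Z} := hYs ▸ ⟨i, rfl⟩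
    exact prime_of_span_eq_vanishingIdealAt hY hZ hxZ (hu0 i) (hu i)
  refine exists_eq_unit_mul_prod_zpow_of_prime hprime hf fun p hp hp1 hup => ?_
  obtain ⟨z, hzx, rfl⟩ := exists_comap_stalkSpecializes_eq x p
  rw [height_comap_stalkSpecializes] at hp1
  refine isUnitAt_of_ord_eq_zero hzx hp1 hf (by_contra fun hord => ?_)
  obtain ⟨Z, hZ, hzZ⟩ := exists_mem_componentsOf (hfY z hp1 hord)
  obtain ⟨i, rfl⟩ : Z ∈ Set.range Ys :=
    hYs ▸ ⟨hZ, hzx.mem_closed (isClosed_of_mem_componentsOf hY hZ) hzZ⟩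
  have hmem : (u i : V.X.presheaf.stalk x) ∈ vanishingIdealAt (Ys i) x :=
    hu i ▸ Ideal.mem_span_singleton_self _
  exact hup i (Ideal.mem_iInf.1 hmem ⟨z, hzZ, hzx⟩)

end Coordinates

end GVariety

theorem lemma4p6_general {k : Type u} [Field k] {G : Type v} [Group G] [Fintype G]
    (hG : (Fintype.card G : k) ≠ 0) (V : GVariety k G) {Y : Set V.X} (hY : IsClosed Y) {x : V.X}
    [IsIntegrallyClosed (V.X.presheaf.stalk x)]
    [Algebra.IsSeparable k (IsLocalRing.ResidueField (V.X.presheaf.stalk x))]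
    {m l : ℕ} {Ys : Fin m → Set V.X}
    (hYs : Set.range Ys = {Z | Z ∈ componentsOf Y ∧ x ∈ Z})
    {u : Fin m → IsLocalRing.maximalIdeal (V.X.presheaf.stalk x)}
    {v : Fin l → IsLocalRing.maximalIdeal (V.X.presheaf.stalk x)}
    (huv : IsLocalCoordinateSystem x (Sum.elim u v))
    (hu : ∀ i, ∀ g : G,
      V.IsLocalEquation (V.toRat x (u i)) ((V.act g).hom '' Ys i) ((V.act g).hom x))
    (e : Fin l → Fin m → ℕ) {f : V.X.functionField} (hf : f ≠ 0) (hfY : V.DivisorSupportedOn f Y) :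
    (∀ i, V.wFun u i ≠ 0 ∧ ∀ g : G, V.ratPullback g (V.wFun u i) = V.wFun u i) ∧
    (∀ j, V.hFun u v e j ≠ 0) ∧
    V.dlog f ∈ Submodule.span (V.toRat x).range
      (Set.range (fun i => V.dlog (V.wFun u i)) ∪
        Set.range (fun j => V.dlog (V.hFun u v e j))) := by
  have hu0 (i : Fin m) : (u i : V.X.presheaf.stalk x) ≠ 0 := huv.ne_zero (Sum.inl i)
  have hv0 (j : Fin l) : (v j : V.X.presheaf.stalk x) ≠ 0 := huv.ne_zero (Sum.inr j)
  refine ⟨fun i => ⟨GVariety.wFun_ne_zero (hu0 i), GVariety.ratPullback_wFun i⟩,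
    fun j => GVariety.hFun_ne_zero hu0 (hv0 j) e, ?_⟩
  obtain ⟨d, n, hd⟩ := hfY.exists_eq_unit_mul_prod_zpow hf hY hYs hu0 fun i =>
    GVariety.span_eq_vanishingIdealAt_of_isLocalEquation (hu i 1)
  choose c hc using fun i => GVariety.exists_wFun_eq_unit_mul_pow (hu i)
  have := Algebra.EssFiniteType.isNoetherianRing k (V.X.presheaf.stalk x)
  have hspan := ideal_span_range_eq_maximalIdeal huv.2
  let D := KaehlerDifferential.D k V.X.functionField
  have hdf : logDifferential D f ∈ _ :=
    hd ▸ span_logDifferential_coordinates_le D hspan hu0 hv0 hG c e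
      (logDifferential_unit_mul_prod_zpow_mem D hspan hu0 hv0 d n)
  simp only [GVariety.dlog, hc]
  exact mem_span_range_algebraMap_of_mem_span hdf

theorem lemma4p6 {k : Type u} [Field k] [CharZero k] {G : Type v} [Group G] [Fintype G]
    (V : GVariety k G) (hqp : V.IsQuasiprojective)
    (Y : Set V.X) (hY : V.IsStandardForm Y)
    (x : V.X) (hx : IsClosed ({x} : Set V.X))
    {m l : ℕ} (Ys : Fin m → Set V.X)
    (u : Fin m → IsLocalRing.maximalIdeal (V.X.presheaf.stalk x))
    (v : Fin l → IsLocalRing.maximalIdeal (V.X.presheaf.stalk x))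
    (e : Fin l → Fin m → ℕ)
    (hcoord : V.IsAdaptedCoordinateSystem Y x Ys u v e)
    (f : V.X.functionField) (hf : f ≠ 0) (hfY : V.DivisorSupportedOn f Y) :
    (∀ i, V.wFun u i ≠ 0 ∧ ∀ g : G, V.ratPullback g (V.wFun u i) = V.wFun u i) ∧
    (∀ j, V.hFun u v e j ≠ 0 ∧ ∀ g : G, V.ratPullback g (V.hFun u v e j) = V.hFun u v e j) ∧
    V.dlog f ∈ Submodule.span (V.toRat x).range
      (Set.range (fun i => V.dlog (V.wFun u i)) ∪
        Set.range (fun j => V.dlog (V.hFun u v e j))) := by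
  have := hY.smooth
  have := V.isIntegrallyClosed_stalk x
  have := V.isAlgebraic_residueField hx
  obtain ⟨hw, hh, hdlog⟩ := lemma4p6_general (Nat.cast_ne_zero.2 Fintype.card_ne_zero) V
    hY.normal_crossing.1 hcoord.components_range hcoord.coordinates hcoord.local_equation e hf hfY
  exact ⟨hw, fun j => ⟨hh j, hcoord.invariant_h j⟩, hdlog⟩
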